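/- Let $K$ be an infinite field of characteristic different from $2$, and let $U_1=\mathrm{Der}_K(K[t,t^{-1}])$ be the Lie algebra of the $K$-derivations of the algebra of Laurent polynomials, with its natural $\mathbb{Z}$-grading $U_1=\bigoplus_{n\in\mathbb{Z}}L_n$, where $L_n$ is the span of $e_n=t^{n+1}\,d/dt$. Let $L\langle X_{\mathbb{Z}}\rangle$ be the free $\mathbb{Z}$-graded Lie algebra over $K$ freely generated by the variables $x_1^{g},x_2^{g},\dots$ of degree $g$, for every $g\in\mathbb{Z}$. A graded identity of $U_1$ is an element of $L\langle X_{\mathbb{Z}}\rangle$ that vanishes whenever each of its variables $x_i^{g}$ is replaced by an element of $L_g$; the graded identities form an ideal $T_{\mathbb{Z}}(U_1)$ of $L\langle X_{\mathbb{Z}}\rangle$. A $T_{\mathbb{Z}}$-ideal is an ideal of $L\langle X_{\mathbb{Z}}\rangle$ that is invariant under all endomorphisms of $L\langle X_{\mathbb{Z}}\rangle$ as a $\mathbb{Z}$-graded Lie algebra, and the $T_{\mathbb{Z}}$-ideal generated by a set $S$ is the intersection of all $T_{\mathbb{Z}}$-ideals that contain $S$. Then the $\mathbb{Z}$-graded identities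 of $U_1$ do not admit any finite basis: there is no finite set $S\subset L\langle X_{\mathbb{Z}}\rangle$ such that $T_{\mathbb{Z}}(U_1)$ is the $T_{\mathbb{Z}}$-ideal generated by $S$. -/

import Mathlib

open scoped LaurentPolynomial

noncomputable section

namespace GradedLie

section Free

variable (K : Type*) [Field K] (G : Type*) [AddCommGroup G]

/-- The free Lie algebra `L⟨X_G⟩` on the variables `x_i^g`, for `g` in `G` and `i` in `ℕ`; the
variable `x_i^g` is `FreeLieAlgebra.of K (g, i)`. -/
abbrev FreeLie : Type _ := FreeLieAlgebra K (G × ℕ)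

variable {K G}

/-- `IsMonomialOfDegree g m`: `m` is a (non-associative) Lie monomial in the variables, and the
degrees of the variables occurring in it, with multiplicity, add up to `g`. -/
inductive IsMonomialOfDegree : G → FreeLie K G → Prop
  | of (g : G) (i : ℕ) : IsMonomialOfDegree g (FreeLieAlgebra.of K (g, i))
  | lie {g h : G} {m n : FreeLie K G} :
      IsMonomialOfDegree g m → IsMonomialOfDegree h n → IsMonomialOfDegree (g + h) ⁅m, n⁆

variable (K) in
/-- The homogeneous component of degree `g` of the free `G`-graded Lie algebra `L⟨X_G⟩`. -/
def freeComponent (g : G) : Submodule K (FreeLie K G) :=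
  Submodule.span K {m | IsMonomialOfDegree g m}

/-- An endomorphism of `L⟨X_G⟩` as a `G`-graded Lie algebra. -/
def IsGradedEndomorphism (φ : FreeLie K G →ₗ⁅K⁆ FreeLie K G) : Prop :=
  ∀ g : G, ∀ f ∈ freeComponent K g, φ f ∈ freeComponent K g

/-- A `T_G`-ideal of `L⟨X_G⟩`: an ideal that is invariant under all graded endomorphisms. -/
def IsTIdeal (I : LieIdeal K (FreeLie K G)) : Prop :=
  ∀ φ : FreeLie K G →ₗ⁅K⁆ FreeLie K G, IsGradedEndomorphism φ → ∀ f ∈ I, φ f ∈ I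

/-- The `T_G`-ideal `⟨S⟩_G` generated by `S`: the intersection of all `T_G`-ideals that
contain `S`. -/
def tIdealSpan (S : Set (FreeLie K G)) : LieIdeal K (FreeLie K G) :=
  sInf {I | IsTIdeal I ∧ S ⊆ (I : Set (FreeLie K G))}

/-- The `T_G`-ideal `I` has a finite basis: it is generated, as a `T_G`-ideal, by a finite set. -/
def HasFiniteBasis (I : LieIdeal K (FreeLie K G)) : Prop :=
  ∃ S : Set (FreeLie K G), S.Finite ∧ tIdealSpan S = I

end Free

section Identities

variable {K : Type*} [Field K] {G : Type*} [AddCommGroup G]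
variable {L : Type*} [LieRing L] [LieAlgebra K L]

/-- An admissible substitution in a Lie algebra with homogeneous components `ℒ g`: every variable
of degree `g` is replaced by an element of `ℒ g`. -/
def IsAdmissible (ℒ : G → Submodule K L) (v : G × ℕ → L) : Prop :=
  ∀ g i, v (g, i) ∈ ℒ g

/-- The ideal `T_G(L)` of the graded identities of a Lie algebra `L` with homogeneous components
`ℒ g`: the polynomials that vanish under every admissible substitution. -/
def gradedIdentities (ℒ : G → Submodule K L) : LieIdeal K (FreeLie K G) where
  carrier := {f | ∀ v : G × ℕ → L, IsAdmissible ℒ v → FreeLieAlgebra.lift K v f = 0}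
  add_mem' hf hg v hv := by rw [map_add, hf v hv, hg v hv, add_zero]
  zero_mem' v _ := map_zero _
  smul_mem' c f hf v hv := by rw [map_smul, hf v hv, smul_zero]
  lie_mem {x f} hf v hv := by rw [LieHom.map_lie, hf v hv, lie_zero]

end Identities

section Witt

variable (K : Type*) [Field K]

/-- The Lie algebra `U₁ = Der(K[t, t⁻¹])`, with the commutator of derivations as its bracket. -/
abbrev U₁ : Type _ := Derivation K K[T;T⁻¹] K[T;T⁻¹]

/-- The `K`-linear map `K[t, t⁻¹] → K[t, t⁻¹]` with `t ^ n ↦ n t ^ (n - 1)`. -/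
def ddtLinear : K[T;T⁻¹] →ₗ[K] K[T;T⁻¹] :=
  (Finsupp.linearCombination K
    (fun n : ℤ => (n : K) • (LaurentPolynomial.T (n - 1) : K[T;T⁻¹]))) ∘ₗ
    (AddMonoidAlgebra.coeffLinearEquiv K).toLinearMap

theorem ddtLinear_T (n : ℤ) :
    ddtLinear K (LaurentPolynomial.T n) = (n : K) • LaurentPolynomial.T (n - 1) := by
  simp only [ddtLinear, LinearMap.comp_apply, LinearEquiv.coe_coe]
  change Finsupp.linearCombination K _ (Finsupp.single n (1 : K)) = _
  rw [Finsupp.linearCombination_single, one_smul]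

/-- The derivation `d/dt` of `K[t, t⁻¹]`. -/
def ddt : U₁ K :=
  Derivation.mk' (ddtLinear K) (by
    intro f g
    induction f using LaurentPolynomial.induction_on' with
    | add p q hp hq => simp only [add_mul, map_add, hp, hq, add_smul, smul_add]; abel
    | C_mul_T m a =>
      induction g using LaurentPolynomial.induction_on' with
      | add p q hp hq => simp only [mul_add, map_add, hp, hq, add_smul, smul_add]; abel
      | C_mul_T n b =>
        have h (c : K) (k : ℤ) : LaurentPolynomial.C c * LaurentPolynomial.T k
            = c • (LaurentPolynomial.T k : K[T;T⁻¹]) := by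
          rw [LaurentPolynomial.smul_eq_C_mul]
        simp only [h, map_smul, ddtLinear_T, smul_eq_mul, smul_mul_smul_comm,
          ← LaurentPolynomial.T_add]
        simp only [mul_smul_comm, ← LaurentPolynomial.T_add]
        rw [show n + (m - 1) = m + n - 1 by ring, show m + (n - 1) = m + n - 1 by ring]
        simp only [smul_smul, ← add_smul]
        congr 1
        push_cast
        ring)

/-- The derivation `e_n = t ^ (n + 1) d/dt` of `K[t, t⁻¹]`. -/
def e (n : ℤ) : U₁ K := (LaurentPolynomial.T (n + 1) : K[T;T⁻¹]) • ddt K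

/-- The natural `ℤ`-grading of `U₁`: the component of degree `n` is the span of `e_n`. -/
def component (n : ℤ) : Submodule K (U₁ K) := Submodule.span K {e K n}

end Witt

end GradedLie

end

/-!
Commutators `[x₁^g, x₂^g]` are identities of `U₁`, since its components are one-dimensional. A
finite set `S` of identities cannot imply all of them: only finitely many degrees occur in `S`, so
for almost every `g` neither `g` nor `2g` does. Grade the Heisenberg algebra `⟨p, q, [p, q]⟩` by
putting `p` and `q` in degree `g` and `[p, q]` in degree `2g`. Every polynomial of `S` vanishes on
it, because its variables can only be replaced by zero, whereas `[p, q] ≠ 0`.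
-/

namespace GradedLie

section FreeLieAlgebra

variable (R : Type*) [CommRing R] {X : Type*}

theorem lieSpan_range_of :
    LieSubalgebra.lieSpan R (FreeLieAlgebra R X) (Set.range (FreeLieAlgebra.of R)) = ⊤ := by
  set H := LieSubalgebra.lieSpan R (FreeLieAlgebra R X) (Set.range (FreeLieAlgebra.of R))
  have of_mem (x : X) : FreeLieAlgebra.of R x ∈ H := LieSubalgebra.subset_lieSpan ⟨x, rfl⟩
  let toSpan : FreeLieAlgebra R X →ₗ⁅R⁆ H := FreeLieAlgebra.lift R fun x ↦ ⟨_, of_mem x⟩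
  have incl_comp_toSpan : H.incl.comp toSpan = LieHom.id := by
    ext x
    simp [toSpan]
  refine eq_top_iff.mpr fun f _ ↦ ?_
  have incl_toSpan : (toSpan f : FreeLieAlgebra R X) = f := LieHom.congr_fun incl_comp_toSpan f
  exact incl_toSpan ▸ (toSpan f).2

variable {R}

theorem exists_finset_lift_eq_of_eqOn (L : Type*) [LieRing L] [LieAlgebra R L]
    (f : FreeLieAlgebra R X) :
    ∃ V : Finset X, ∀ v w : X → L, Set.EqOn v w V →
      FreeLieAlgebra.lift R v f = FreeLieAlgebra.lift R w f := by
  classical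
  have hf : f ∈ LieSubalgebra.lieSpan R (FreeLieAlgebra R X) (Set.range (FreeLieAlgebra.of R)) :=
    lieSpan_range_of R ▸ LieSubalgebra.mem_top f
  induction hf using LieSubalgebra.lieSpan_induction with
  | mem f hf =>
    obtain ⟨x, rfl⟩ := hf
    exact ⟨{x}, fun v w h ↦ by simpa using h⟩
  | zero => exact ⟨∅, fun v w _ ↦ by simp only [map_zero]⟩
  | add a b _ _ ha hb =>
    obtain ⟨V, hV⟩ := ha
    obtain ⟨W, hW⟩ := hb
    refine ⟨V ∪ W, fun v w h ↦ ?_⟩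
    rw [Finset.coe_union, Set.eqOn_union] at h
    rw [map_add, map_add, hV v w h.1, hW v w h.2]
  | smul c a _ ha =>
    obtain ⟨V, hV⟩ := ha
    exact ⟨V, fun v w h ↦ by rw [map_smul, map_smul, hV v w h]⟩
  | lie a b _ _ ha hb =>
    obtain ⟨V, hV⟩ := ha
    obtain ⟨W, hW⟩ := hb
    refine ⟨V ∪ W, fun v w h ↦ ?_⟩
    rw [Finset.coe_union, Set.eqOn_union] at h
    rw [LieHom.map_lie, LieHom.map_lie, hV v w h.1, hW v w h.2]

theorem lift_zero (L : Type*) [LieRing L] [LieAlgebra R L] :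
    FreeLieAlgebra.lift R (0 : X → L) = 0 := by
  ext x
  simp only [FreeLieAlgebra.lift_of_apply, Pi.zero_apply, LieHom.zero_apply]

end FreeLieAlgebra

section GradedIdentities

variable {K : Type*} [Field K] {G : Type*}
variable {L : Type*} [LieRing L] [LieAlgebra K L] {ℒ : G → Submodule K L}

theorem lie_of_of_mem_gradedIdentities_iff {p q : G × ℕ} (hpq : p ≠ q) :
    ⁅FreeLieAlgebra.of K p, FreeLieAlgebra.of K q⁆ ∈ gradedIdentities ℒ ↔
      ∀ x ∈ ℒ p.1, ∀ y ∈ ℒ q.1, ⁅x, y⁆ = 0 := by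
  classical
  constructor
  · intro hmem x hx y hy
    let v : G × ℕ → L := Function.update (Function.update 0 p x) q y
    have hv : IsAdmissible ℒ v := by
      intro g i
      by_cases hq : (g, i) = q
      · subst hq
        simpa only [v, Function.update_self] using hy
      by_cases hp : (g, i) = p
      · subst hp
        simpa only [v, Function.update_of_ne hq, Function.update_self] using hx
      simp only [v, Function.update_of_ne hq, Function.update_of_ne hp, Pi.zero_apply, zero_mem]
    simpa [v, hpq] using hmem v hv
  · intro hcomm v hv
    rw [LieHom.map_lie, FreeLieAlgebra.lift_of_apply, FreeLieAlgebra.lift_of_apply]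
    exact hcomm _ (hv p.1 p.2) _ (hv q.1 q.2)

theorem exists_finset_subset_gradedIdentities (L : Type*) [LieRing L] [LieAlgebra K L]
    {S : Set (FreeLie K G)} (hS : S.Finite) :
    ∃ D : Finset G, ∀ ℒ : G → Submodule K L, (∀ g ∈ D, ℒ g = ⊥) →
      S ⊆ gradedIdentities ℒ := by
  classical
  choose V hV using fun f : FreeLie K G ↦ exists_finset_lift_eq_of_eqOn L f
  refine ⟨(hS.toFinset.biUnion V).image Prod.fst, fun ℒ hℒ f hf v hv ↦ ?_⟩
  have v_eq_zero : Set.EqOn v 0 (V f) := by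
    intro p hp
    have hbot : ℒ p.1 = ⊥ := hℒ p.1 <| Finset.mem_image_of_mem _ <|
      Finset.mem_biUnion.mpr ⟨f, hS.mem_toFinset.mpr hf, hp⟩
    exact (Submodule.mem_bot K).mp (hbot ▸ hv p.1 p.2)
  rw [hV f v 0 v_eq_zero, lift_zero, LieHom.zero_apply]

variable [AddCommGroup G]

theorem lift_mem_of_mem_freeComponent [SetLike.GradedBracket ℒ] {v : G × ℕ → L}
    (hv : IsAdmissible ℒ v) {g : G} {f : FreeLie K G} (hf : f ∈ freeComponent K g) :
    FreeLieAlgebra.lift K v f ∈ ℒ g := by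
  induction hf using Submodule.span_induction with
  | mem m hm =>
    induction hm with
    | of g i => simpa only [FreeLieAlgebra.lift_of_apply] using hv g i
    | lie _ _ ha hb =>
      simpa only [LieHom.map_lie] using SetLike.GradedBracket.bracket_mem ha hb
  | zero => simp only [map_zero, zero_mem]
  | add x y _ _ hx hy => simpa only [map_add] using add_mem hx hy
  | smul c x _ hx => simpa only [map_smul] using (ℒ g).smul_mem c hx

variable (ℒ) in
theorem isTIdeal_gradedIdentities [SetLike.GradedBracket ℒ] : IsTIdeal (gradedIdentities ℒ) := by
  intro φ hφ f hf v hv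
  have lift_comp : (FreeLieAlgebra.lift K v).comp φ =
      FreeLieAlgebra.lift K fun p ↦ FreeLieAlgebra.lift K v (φ (FreeLieAlgebra.of K p)) := by
    ext p
    simp only [LieHom.comp_apply, FreeLieAlgebra.lift_of_apply]
  rw [← LieHom.comp_apply, lift_comp]
  exact hf _ fun g i ↦ lift_mem_of_mem_freeComponent hv
    (hφ g _ (Submodule.subset_span (IsMonomialOfDegree.of g i)))

theorem tIdealSpan_le {S : Set (FreeLie K G)} {I : LieIdeal K (FreeLie K G)} (hI : IsTIdeal I)
    (hS : S ⊆ I) : tIdealSpan S ≤ I :=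
  sInf_le ⟨hI, hS⟩

end GradedIdentities

section StrictUpperTriangular

attribute [local instance 100] LieRing.ofAssociativeRing

variable {n : Type*} [Preorder n] {G : Type*} [AddCommSemigroup G]

/-- The homogeneous component of degree `g` of the algebra of strictly upper triangular matrices, in
the elementary grading defined by `d : n → G`: the `(i, j)` entry has degree `d j - d i`. -/
def strictUpperComponent (R : Type*) [Semiring R] (d : n → G) (g : G) :
    Submodule R (Matrix n n R) where
  carrier := {A | ∀ i j, A i j ≠ 0 → i < j ∧ d i + g = d j}
  add_mem' {A B} hA hB i j hij := by
    by_cases hAij : A i j = 0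
    · exact hB i j fun hBij ↦ hij (by rw [Matrix.add_apply, hAij, hBij, add_zero])
    · exact hA i j hAij
  zero_mem' _ _ hij := absurd rfl hij
  smul_mem' c A hA i j hij := hA i j fun hAij ↦
    hij (by rw [Matrix.smul_apply, hAij, smul_zero])

instance (R : Type*) [Semiring R] [Fintype n] (d : n → G) :
    SetLike.GradedMul (strictUpperComponent R d) where
  mul_mem g h A B hA hB i j hij := by
    obtain ⟨l, -, hl⟩ := Finset.exists_ne_zero_of_sum_ne_zero hij
    obtain ⟨hil, hdil⟩ := hA i l (left_ne_zero_of_mul hl)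
    obtain ⟨hlj, hdlj⟩ := hB l j (right_ne_zero_of_mul hl)
    exact ⟨hil.trans hlj, by rw [← add_assoc, hdil, hdlj]⟩

instance (R : Type*) [Ring R] [Fintype n] (d : n → G) :
    SetLike.GradedBracket (strictUpperComponent R d) where
  bracket_mem g h A B hA hB := by
    rw [Ring.lie_def]
    exact sub_mem (SetLike.mul_mem_graded hA hB) (add_comm h g ▸ SetLike.mul_mem_graded hB hA)

variable (R : Type*) [Semiring R]

theorem strictUpperComponent_eq_bot {d : n → G} {g : G} (hg : ∀ i j, i < j → d i + g ≠ d j) :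
    strictUpperComponent R d g = ⊥ := by
  refine (Submodule.eq_bot_iff _).mpr fun A hA ↦ ?_
  ext i j
  by_contra hij
  obtain ⟨hlt, hd⟩ := hA i j hij
  exact hg i j hlt hd

variable {R}

theorem single_mem_strictUpperComponent [DecidableEq n] {d : n → G} {g : G} {i j : n}
    (hij : i < j) (hg : d i + g = d j) (c : R) :
    Matrix.single i j c ∈ strictUpperComponent R d g := by
  intro a b hab
  obtain ⟨rfl, rfl⟩ : i = a ∧ j = b := by
    by_contra hne
    exact hab (Matrix.single_apply_of_ne _ _ _ _ _ hne)
  exact ⟨hij, hg⟩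

end StrictUpperTriangular

section Heisenberg

attribute [local instance 100] LieRing.ofAssociativeRing

variable {G : Type*} [AddCommGroup G]

/-- The `G`-grading of the Heisenberg algebra, realized as the strictly upper triangular `3 × 3`
matrices, with both generators `E₀₁` and `E₁₂` in degree `g` and the centre `E₀₂` in degree `2g`. -/
abbrev heisenbergComponent (R : Type*) [Semiring R] (g : G) :
    G → Submodule R (Matrix (Fin 3) (Fin 3) R) :=
  strictUpperComponent R fun i : Fin 3 ↦ (i : ℕ) • g

theorem heisenbergComponent_eq_bot (R : Type*) [Semiring R] {g h : G} (h₁ : h ≠ g)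
    (h₂ : h ≠ 2 • g) : heisenbergComponent R g h = ⊥ := by
  refine strictUpperComponent_eq_bot R fun i j hij ↦ ?_
  fin_cases i <;> fin_cases j <;> simp_all [two_nsmul]

theorem exists_lie_ne_zero_heisenbergComponent (R : Type*) [Ring R] [Nontrivial R] (g : G) :
    ∃ A ∈ heisenbergComponent R g g, ∃ B ∈ heisenbergComponent R g g, ⁅A, B⁆ ≠ 0 := by
  refine ⟨Matrix.single 0 1 1, single_mem_strictUpperComponent (by decide) (by simp) 1,
    Matrix.single 1 2 1, single_mem_strictUpperComponent (by decide) (by simp [two_nsmul]) 1, ?_⟩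
  intro hzero
  simpa [Ring.lie_def] using congrFun₂ hzero 0 2

theorem finite_setOf_lie_of_of_mem_tIdealSpan {K : Type*} [Field K] [IsAddTorsionFree G]
    {S : Set (FreeLie K G)} (hS : S.Finite) {i j : ℕ} (hij : i ≠ j) :
    {g : G | ⁅FreeLieAlgebra.of K (g, i), FreeLieAlgebra.of K (g, j)⁆ ∈ tIdealSpan S}.Finite := by
  obtain ⟨D, hD⟩ := exists_finset_subset_gradedIdentities (Matrix (Fin 3) (Fin 3) K) hS
  have finite_half : ((2 • · : G → G) ⁻¹' D).Finite :=
    D.finite_toSet.preimage (nsmul_right_injective two_ne_zero).injOn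
  refine (D.finite_toSet.union finite_half).subset fun g hg ↦ ?_
  by_contra hgD
  obtain ⟨hg₁, hg₂⟩ : g ∉ D ∧ 2 • g ∉ D := not_or.mp hgD
  have hSI : S ⊆ gradedIdentities (heisenbergComponent K g) := hD _ fun h hh ↦
    heisenbergComponent_eq_bot K (ne_of_mem_of_not_mem hh hg₁) (ne_of_mem_of_not_mem hh hg₂)
  have hcomm := (lie_of_of_mem_gradedIdentities_iff (by simpa using hij)).mp
    (tIdealSpan_le (isTIdeal_gradedIdentities _) hSI hg)
  obtain ⟨A, hA, B, hB, hAB⟩ := exists_lie_ne_zero_heisenbergComponent K g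
  exact hAB (hcomm A hA B hB)

end Heisenberg

theorem lie_eq_zero_of_mem_span_singleton {R L : Type*} [CommRing R] [LieRing L] [LieAlgebra R L]
    {x y z : L} (hx : x ∈ Submodule.span R {z}) (hy : y ∈ Submodule.span R {z}) : ⁅x, y⁆ = 0 := by
  obtain ⟨a, rfl⟩ := Submodule.mem_span_singleton.mp hx
  obtain ⟨b, rfl⟩ := Submodule.mem_span_singleton.mp hy
  rw [smul_lie, lie_smul, lie_self, smul_zero, smul_zero]

end GradedLie

theorem mainTheorem6_general {K : Type*} [Field K] {G : Type*} [AddCommGroup G]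
    [IsAddTorsionFree G] {L : Type*} [LieRing L] [LieAlgebra K L] {ℒ : G → Submodule K L}
    (hℒ : {g | ∀ x ∈ ℒ g, ∀ y ∈ ℒ g, ⁅x, y⁆ = 0}.Infinite) :
    ¬ GradedLie.HasFiniteBasis (GradedLie.gradedIdentities ℒ) := by
  rintro ⟨S, hS, hspan⟩
  refine hℒ ((GradedLie.finite_setOf_lie_of_of_mem_tIdealSpan hS zero_ne_one).subset fun g hg ↦ ?_)
  rw [Set.mem_ofPred_eq, hspan]
  exact (GradedLie.lie_of_of_mem_gradedIdentities_iff (by simp)).mpr hg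

theorem mainTheorem6 (K : Type*) [Field K] [Infinite K] (hK : ringChar K ≠ 2) :
    ¬ GradedLie.HasFiniteBasis (GradedLie.gradedIdentities (GradedLie.component K)) :=
  mainTheorem6_general <| Set.infinite_univ.mono fun _ _ _ hx _ hy ↦
    GradedLie.lie_eq_zero_of_mem_span_singleton hx hy
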